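/- Let $\mathsf{ZFA}$ be the first-order theory in the language $\{\in\}$ obtained from $\mathsf{ZFC}$ by replacing the Axiom of Foundation with the Anti-Foundation Axiom: every flat system of equations has a unique solution. (A flat system is given by disjoint sets $X$, $A$ and a function $x\mapsto S_x$ on $X$ with $S_x\subseteq X\cup A$; a solution is a function $f$ on $X$ such that $f(x)=\{f(w): w\in S_x\cap X\}\cup(S_x\cap A)$ for all $x\in X$.) For an $\{\in\}$-structure $M$ put $S(x,y):\Leftrightarrow x\in y\lor y\in x$ and $D(x,y):\Leftrightarrow x\in y\land y\in x$. The SD-graph $M_0$ of $M$ is the $\{S,D\}$-structure $(M;S,D)$, and the D-graph $M_1$ of $M$ is the $\{D\}$-structure $(M;D)$. Let $M$ be a model of $\mathsf{ZFA}$. Then: 1. There is a set of $2^{\aleph_0}$ countable models of $\mathsf{ZFA}$ whose D-graphs are elementarily equivalent to $M_1$ and pairwise non-isomorphic. 2. There is a set of $2^{\aleph_0}$ countable models of $\mathsf{ZFA}$ whose SD-graphs are elementarily equivalent to $M_0$ and pairwise non-isomorphic. 3. Up to isomorphism there are exactly $2^{\aleph_0}$ countable D-graphs of models of $\mathsf{ZFA}$,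 and exactly $2^{\aleph_0}$ countable SD-graphs of models of $\mathsf{ZFA}$. 4. Up to isomorphism, the complete theory $\mathrm{Th}(M_1)$ has exactly $2^{\aleph_0}$ countable models, and so does $\mathrm{Th}(M_0)$. -/

import Mathlib

open FirstOrder FirstOrder.Language CategoryTheory
universe u

/-! ### The languages `{∈}`, `{S, D}` and `{D}` -/

/-- The only symbol of the language of set theory: binary membership. -/
inductive MemSymb : ℕ → Type
  | mem : MemSymb 2

/-- The language `L = {∈}` of set theory. -/
def langSet : FirstOrder.Language.{0, 0} := ⟨fun _ => Empty, MemSymb⟩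

/-- The symbols of the language of single-double-membership graphs. -/
inductive SDSymb : ℕ → Type
  | S : SDSymb 2
  | D : SDSymb 2

/-- The language `L₀ = {S, D}`. -/
def langSD : FirstOrder.Language.{0, 0} := ⟨fun _ => Empty, SDSymb⟩

/-- The only symbol of the language of double-membership graphs. -/
inductive DSymb : ℕ → Type
  | D : DSymb 2

/-- The language `L₁ = {D}`. -/
def langD : FirstOrder.Language.{0, 0} := ⟨fun _ => Empty, DSymb⟩

/-! ### The graphs attached to an `{∈}`-structure -/

/-- The membership relation of an `{∈}`-structure. -/
def MemRel {M : Type*} [langSet.Structure M] (x y : M) : Prop :=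
  Structure.RelMap (L := langSet) MemSymb.mem ![x, y]

/-- The domain of the single-double-membership graph `M₀` of `M` is that of `M`. -/
def SDGraph (M : Type u) : Type u := M

/-- The domain of the double-membership graph `M₁` of `M` is that of `M`. -/
def DGraph (M : Type u) : Type u := M

/-- `M₀`: the relation `S` is `x ∈ y ∨ y ∈ x` and the relation `D` is `x ∈ y ∧ y ∈ x`. -/
instance SDGraph.structure (M : Type*) [langSet.Structure M] :
    langSD.Structure (SDGraph M) where
  funMap f _ := Empty.elim f
  RelMap
    | SDSymb.S => fun v => MemRel (M := M) (v 0) (v 1) ∨ MemRel (M := M) (v 1) (v 0)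
    | SDSymb.D => fun v => MemRel (M := M) (v 0) (v 1) ∧ MemRel (M := M) (v 1) (v 0)

/-- `M₁`: the relation `D` is `x ∈ y ∧ y ∈ x`. -/
instance DGraph.structure (M : Type*) [langSet.Structure M] :
    langD.Structure (DGraph M) where
  funMap f _ := Empty.elim f
  RelMap
    | DSymb.D => fun v => MemRel (M := M) (v 0) (v 1) ∧ MemRel (M := M) (v 1) (v 0)

/-! ### Formulas of set theory

In a `BoundedFormula α n` the quantified variables in scope are numbered `0, …, n - 1`, and
the next quantifier binds the variable number `n`. -/

namespace SetForm

variable {α : Type} {n : ℕ}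

/-- `xᵢ ∈ xⱼ` -/
def mem (i j : Fin n) : langSet.BoundedFormula α n :=
  Relations.boundedFormula₂ (L := langSet) MemSymb.mem (Term.var (Sum.inr i)) (Term.var (Sum.inr j))

/-- `xᵢ = xⱼ` -/
def eq (i j : Fin n) : langSet.BoundedFormula α n :=
  Term.bdEqual (Term.var (Sum.inr i)) (Term.var (Sum.inr j))

/-- `p = {x, y}` -/
def isPair (p x y : Fin n) : langSet.BoundedFormula α n :=
  ∀' (mem (Fin.last n) p.castSucc ⇔
    (eq (Fin.last n) x.castSucc ⊔ eq (Fin.last n) y.castSucc))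

/-- `p = (x, y)`, the Kuratowski pair `{{x}, {x, y}}` -/
def isOrdPair (p x y : Fin n) : langSet.BoundedFormula α n :=
  ∃' ∃' (isPair (Fin.last n).castSucc x.castSucc.castSucc x.castSucc.castSucc ⊓
    isPair (Fin.last (n + 1)) x.castSucc.castSucc y.castSucc.castSucc ⊓
    isPair p.castSucc.castSucc (Fin.last n).castSucc (Fin.last (n + 1)))

/-- `(x, y) ∈ f` -/
def pairMem (f x y : Fin n) : langSet.BoundedFormula α n :=
  ∃' (isOrdPair (Fin.last n) x.castSucc y.castSucc ⊓ mem (Fin.last n) f.castSucc)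

/-- `f` is a function with domain `X`: every element of `f` is a pair whose first component is in
`X`, and for every `x ∈ X` there is exactly one `y` with `(x, y) ∈ f`. -/
def isFunOn (f X : Fin n) : langSet.BoundedFormula α n :=
  (∀' (mem (Fin.last n) f.castSucc ⟹
    ∃' ∃' (mem (Fin.last (n + 1)).castSucc X.castSucc.castSucc.castSucc ⊓
      isOrdPair (Fin.last n).castSucc.castSucc (Fin.last (n + 1)).castSucc
        (Fin.last (n + 2))))) ⊓
  (∀' (mem (Fin.last n) X.castSucc ⟹
    ∃' (pairMem f.castSucc.castSucc (Fin.last n).castSucc (Fin.last (n + 1)) ⊓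
      ∀' (pairMem f.castSucc.castSucc.castSucc (Fin.last n).castSucc.castSucc (Fin.last (n + 2)) ⟹
        eq (Fin.last (n + 2)) (Fin.last (n + 1)).castSucc))))

/-- `(X, A, e)` is a flat system of equations `x = e(x)`, `x ∈ X`: the set `X` of indeterminates is
disjoint from the set `A`, and `e` is a function with domain `X` such that `e(x) ⊆ X ∪ A`
for every `x ∈ X`. -/
def isFlatSystem (X A e : Fin n) : langSet.BoundedFormula α n :=
  (∀' ∼(mem (Fin.last n) X.castSucc ⊓ mem (Fin.last n) A.castSucc)) ⊓
  isFunOn e X ⊓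
  (∀' ∀' ((mem (Fin.last n).castSucc X.castSucc.castSucc ⊓
      pairMem e.castSucc.castSucc (Fin.last n).castSucc (Fin.last (n + 1))) ⟹
    ∀' (mem (Fin.last (n + 2)) (Fin.last (n + 1)).castSucc ⟹
      (mem (Fin.last (n + 2)) X.castSucc.castSucc.castSucc ⊔
        mem (Fin.last (n + 2)) A.castSucc.castSucc.castSucc))))

/-- `f` is a solution of the flat system `(X, A, e)`: it is a function with domain `X`, and whenever
`x ∈ X`, `s = e(x)` and `y = f(x)`, the elements of `y` are exactly the `f(w)` for
`w ∈ s ∩ X` and the elements of `s ∩ A`. -/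
def isSolution (X A e f : Fin n) : langSet.BoundedFormula α n :=
  isFunOn f X ⊓
  (∀' ∀' ∀' ((mem (Fin.last n).castSucc.castSucc X.castSucc.castSucc.castSucc ⊓
      pairMem e.castSucc.castSucc.castSucc (Fin.last n).castSucc.castSucc
        (Fin.last (n + 1)).castSucc ⊓
      pairMem f.castSucc.castSucc.castSucc (Fin.last n).castSucc.castSucc
        (Fin.last (n + 2))) ⟹
    ∀' (mem (Fin.last (n + 3)) (Fin.last (n + 2)).castSucc ⇔
      ((∃' (mem (Fin.last (n + 4)) (Fin.last (n + 1)).castSucc.castSucc.castSucc ⊓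
          mem (Fin.last (n + 4)) X.castSucc.castSucc.castSucc.castSucc.castSucc ⊓
          pairMem f.castSucc.castSucc.castSucc.castSucc.castSucc (Fin.last (n + 4))
            (Fin.last (n + 3)).castSucc)) ⊔
        (mem (Fin.last (n + 3)) (Fin.last (n + 1)).castSucc.castSucc ⊓
          mem (Fin.last (n + 3)) A.castSucc.castSucc.castSucc.castSucc)))))

/-- The universal closure of a formula in `n` free variables. -/
def closure (φ : langSet.Formula (Fin n)) : langSet.Sentence :=
  (BoundedFormula.relabel (Sum.inr : Fin n → Empty ⊕ Fin n) φ).alls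

end SetForm

/-! ### The axioms of `ZFA` -/

namespace ZFAxiom

open SetForm

/-- Two sets with the same elements are equal. -/
def extensionality : langSet.Sentence :=
  ∀' ∀' ((∀' (mem 2 0 ⇔ mem 2 1)) ⟹ eq 0 1)

/-- For all `x`, `y` there is a set `{x, y}`. -/
def pairing : langSet.Sentence :=
  ∀' ∀' ∃' isPair 2 0 1

/-- For every `a` there is a set `⋃ a`. -/
def union : langSet.Sentence :=
  ∀' ∃' ∀' (mem 2 1 ⇔ ∃' (mem 3 0 ⊓ mem 2 3))

/-- For every `a` there is a set of all subsets of `a`. -/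
def powerset : langSet.Sentence :=
  ∀' ∃' ∀' (mem 2 1 ⇔ ∀' (mem 3 2 ⟹ mem 3 0))

/-- There is a set that contains an empty set and, with each `x`, also `x ∪ {x}`. -/
def infinity : langSet.Sentence :=
  ∃' ((∃' (mem 1 0 ⊓ ∀' ∼(mem 2 1))) ⊓
    ∀' (mem 1 0 ⟹ ∃' (mem 2 0 ⊓ ∀' (mem 3 2 ⇔ (mem 3 1 ⊔ eq 3 1)))))

/-- Every set `a` of nonempty, pairwise disjoint sets has a transversal: a set `c` that meets each
element of `a` in exactly one point. -/
def choice : langSet.Sentence :=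
  ∀' (((∀' (mem 1 0 ⟹ ∃' mem 2 1)) ⊓
      (∀' ∀' ∀' ((mem 1 0 ⊓ mem 2 0 ⊓ mem 3 1 ⊓ mem 3 2) ⟹ eq 1 2))) ⟹
    ∃' ∀' (mem 2 0 ⟹
      ∃' ((mem 3 1 ⊓ mem 3 2) ⊓ ∀' ((mem 4 1 ⊓ mem 4 2) ⟹ eq 4 3))))

/-- Separation for the formula `φ(p; x)`: for all parameters `p` and every `a` there is a `b` such
that `x ∈ b ↔ x ∈ a ∧ φ(p; x)` for all `x`. -/
def separation {k : ℕ} (φ : langSet.Formula (Fin k ⊕ Fin 1)) : langSet.Sentence :=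
  SetForm.closure (n := k) (∀' ∃' ∀' (mem (n := 3) 2 1 ⇔ (mem (n := 3) 2 0 ⊓
    BoundedFormula.relabel (Sum.map id ![2] : Fin k ⊕ Fin 1 → Fin k ⊕ Fin 3) φ)))

/-- Replacement for the formula `φ(p; x, y)`: for all parameters `p` and every `a`, if for each
`x ∈ a` there is at most one `y` with `φ(p; x, y)`, then there is a `b` such that
`y ∈ b ↔ ∃ x ∈ a, φ(p; x, y)` for all `y`. -/
def replacement {k : ℕ} (φ : langSet.Formula (Fin k ⊕ Fin 2)) : langSet.Sentence :=
  SetForm.closure (n := k) (∀' (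
    (∀' ∀' ∀' ((mem (n := 4) 1 0 ⊓
        BoundedFormula.relabel (Sum.map id ![1, 2] : Fin k ⊕ Fin 2 → Fin k ⊕ Fin 4) φ ⊓
        BoundedFormula.relabel (Sum.map id ![1, 3] : Fin k ⊕ Fin 2 → Fin k ⊕ Fin 4) φ) ⟹
      eq 2 3)) ⟹
    ∃' ∀' (mem (n := 3) 2 1 ⇔ ∃' (mem (n := 4) 3 0 ⊓
      BoundedFormula.relabel (Sum.map id ![3, 2] : Fin k ⊕ Fin 2 → Fin k ⊕ Fin 4) φ))))

/-- The Anti-Foundation Axiom: every flat system of equations has a unique solution. -/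
def antiFoundation : langSet.Sentence :=
  ∀' ∀' ∀' (isFlatSystem 0 1 2 ⟹
    ∃' (isSolution 0 1 2 3 ⊓ ∀' (isSolution 0 1 2 4 ⟹ eq 4 3)))

end ZFAxiom

/-- The theory `ZFA`: `ZFC` with the Axiom of Foundation replaced by the Anti-Foundation Axiom. -/
def ZFA : langSet.Theory :=
  {ZFAxiom.extensionality, ZFAxiom.pairing, ZFAxiom.union, ZFAxiom.powerset, ZFAxiom.infinity,
    ZFAxiom.choice, ZFAxiom.antiFoundation} ∪
  {σ | ∃ (k : ℕ) (φ : langSet.Formula (Fin k ⊕ Fin 1)), σ = ZFAxiom.separation φ} ∪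
  {σ | ∃ (k : ℕ) (φ : langSet.Formula (Fin k ⊕ Fin 2)), σ = ZFAxiom.replacement φ}

/-! ### Isomorphism classes of countable structures -/

/-- The isomorphism classes of the countable `L`-structures with the property `P`. -/
def countableIsoClasses (L : FirstOrder.Language.{0, 0}) (P : Bundled.{0} L.Structure → Prop) :
    Set (Quotient (FirstOrder.Language.equivSetoid (L := L))) :=
  {c | ∃ N : Bundled.{0} L.Structure, Countable N ∧ P N ∧ c = Quotient.mk _ N}

/-!
The D-graph of a model `M` of `ZFA` contains every finite symmetric graph without isolated vertices
as a union of connected components. Indeed anti-foundation solves the system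
`x_v = {x_w | w adjacent to v} ∪ {a_v}`, where the parameters `a_v` are distinct numerals; these
are well-founded, so they distinguish the `x_v` without contributing edges
(`exists_embedding_of_finite_graph`). Only extensionality, pairing, union, the empty set and
anti-foundation are needed.

Say that a vertex `x` of a graph codes the set of those `n` for which some neighbour of `x` has
exactly `n + 1` neighbours. For fixed `n` this is a first-order condition on the D-graph. A tree of
height two realised in `M` codes any given finite nonempty set (`exists_codes_iff_mem`), so by
compactness and the downward Löwenheim–Skolem theorem every `b ⊆ ℕ` is coded in a countable model
elementarily equivalent to `M` (`exists_countable_model_codes`). A countable model codes only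
countably many sets, and isomorphic D-graphs code the same ones. Hence there are continuum many
isomorphism classes among these D-graphs (`exists_continuum_pairwise_not_iso`).

The D-graph is definable in the SD-graph, and both are definable in `M`. Therefore the same models
have pairwise non-isomorphic SD-graphs, and both graphs keep their complete theories
(`elementarilyEquivalent_of_unfoldRelations`). Conversely, a countable structure in a countable
relational language is determined up to isomorphism by a pair of sets of codes, so there are at most
continuum many of them (`mk_countableIsoClasses_le`).
-/

/-! ### Semantics of the formulas of set theory -/

section Semantics

variable {M : Type*} [langSet.Structure M]

/-- `p` is the unordered pair of `x` and `y`. -/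
def IsPair (p x y : M) : Prop := ∀ z, MemRel z p ↔ z = x ∨ z = y

/-- `p` is the Kuratowski pair of `x` and `y`. -/
def IsOrdPair (p x y : M) : Prop := ∃ q r, IsPair q x x ∧ IsPair r x y ∧ IsPair p q r

/-- The ordered pair of `x` and `y` belongs to `f`. -/
def PairMem (f x y : M) : Prop := ∃ p, IsOrdPair p x y ∧ MemRel p f

variable {α : Type} {n : ℕ} {v : α → M} {xs : Fin n → M}

@[simp] theorem realize_mem {i j : Fin n} :
    (SetForm.mem i j : langSet.BoundedFormula α n).Realize v xs ↔ MemRel (xs i) (xs j) := by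
  simp only [SetForm.mem]
  exact BoundedFormula.realize_rel₂

@[simp] theorem realize_eq {i j : Fin n} :
    (SetForm.eq i j : langSet.BoundedFormula α n).Realize v xs ↔ xs i = xs j := by
  simp [SetForm.eq]

@[simp] theorem realize_isPair {i j k : Fin n} :
    (SetForm.isPair i j k : langSet.BoundedFormula α n).Realize v xs ↔
      IsPair (xs i) (xs j) (xs k) := by
  simp [SetForm.isPair, IsPair]

@[simp] theorem realize_isOrdPair {i j k : Fin n} :
    (SetForm.isOrdPair i j k : langSet.BoundedFormula α n).Realize v xs ↔
      IsOrdPair (xs i) (xs j) (xs k) := by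
  simp [SetForm.isOrdPair, IsOrdPair, and_assoc]

@[simp] theorem realize_pairMem {i j k : Fin n} :
    (SetForm.pairMem i j k : langSet.BoundedFormula α n).Realize v xs ↔
      PairMem (xs i) (xs j) (xs k) := by
  simp [SetForm.pairMem, PairMem]

/-- `f` is a function with domain `X`. -/
def IsFunOn (f X : M) : Prop :=
  (∀ p, MemRel p f → ∃ x y, MemRel x X ∧ IsOrdPair p x y) ∧
    ∀ x, MemRel x X → ∃ y, PairMem f x y ∧ ∀ z, PairMem f x z → z = y

@[simp] theorem realize_isFunOn {i j : Fin n} :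
    (SetForm.isFunOn i j : langSet.BoundedFormula α n).Realize v xs ↔
      IsFunOn (xs i) (xs j) := by
  simp [SetForm.isFunOn, IsFunOn]

/-- `(X, A, e)` is a flat system of equations. -/
def IsFlatSystem (X A e : M) : Prop :=
  (∀ x, ¬ (MemRel x X ∧ MemRel x A)) ∧ IsFunOn e X ∧
    ∀ x s, MemRel x X ∧ PairMem e x s → ∀ z, MemRel z s → MemRel z X ∨ MemRel z A

@[simp] theorem realize_isFlatSystem {i j k : Fin n} :
    (SetForm.isFlatSystem i j k : langSet.BoundedFormula α n).Realize v xs ↔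
      IsFlatSystem (xs i) (xs j) (xs k) := by
  simp [SetForm.isFlatSystem, IsFlatSystem, and_assoc]

/-- `f` is a solution of the flat system `(X, A, e)`. -/
def IsSolution (X A e f : M) : Prop :=
  IsFunOn f X ∧
    ∀ x s y, MemRel x X ∧ PairMem e x s ∧ PairMem f x y →
      ∀ z, MemRel z y ↔
        (∃ w, MemRel w s ∧ MemRel w X ∧ PairMem f w z) ∨ (MemRel z s ∧ MemRel z A)

@[simp] theorem realize_isSolution {i j k l : Fin n} :
    (SetForm.isSolution i j k l : langSet.BoundedFormula α n).Realize v xs ↔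
      IsSolution (xs i) (xs j) (xs k) (xs l) := by
  simp [SetForm.isSolution, IsSolution, and_assoc]

end Semantics

/-! ### Finite sets in a model of `ZFA` -/

section FiniteSets

variable {M : Type*} [langSet.Structure M]

theorem ext_of_model (hM : M ⊨ ZFA) {x y : M} (h : ∀ z, MemRel z x ↔ MemRel z y) : x = y := by
  have := hM.realize_of_mem ZFAxiom.extensionality (by simp [ZFA])
  simp [ZFAxiom.extensionality, Sentence.Realize, Formula.Realize, Fin.snoc] at this
  exact this x y h

theorem exists_isPair (hM : M ⊨ ZFA) (x y : M) : ∃ p, IsPair p x y := by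
  have := hM.realize_of_mem ZFAxiom.pairing (by simp [ZFA])
  simp [ZFAxiom.pairing, Sentence.Realize, Formula.Realize, Fin.snoc] at this
  exact this x y

theorem exists_biUnion_set (hM : M ⊨ ZFA) (a : M) :
    ∃ u, ∀ z, MemRel z u ↔ ∃ y, MemRel y a ∧ MemRel z y := by
  have := hM.realize_of_mem ZFAxiom.union (by simp [ZFA])
  simp [ZFAxiom.union, Sentence.Realize, Formula.Realize, Fin.snoc] at this
  exact this a

theorem exists_empty (hM : M ⊨ ZFA) : ∃ a : M, ∀ z, ¬ MemRel z a := by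
  have := hM.realize_of_mem ZFAxiom.infinity (by simp [ZFA])
  simp [ZFAxiom.infinity, Sentence.Realize, Formula.Realize, Fin.snoc] at this
  obtain ⟨_, ⟨a, _, ha⟩, _⟩ := this
  exact ⟨a, ha⟩

theorem exists_solution (hM : M ⊨ ZFA) {X A e : M} (h : IsFlatSystem X A e) :
    ∃ f, IsSolution X A e f := by
  have := hM.realize_of_mem ZFAxiom.antiFoundation (by simp [ZFA])
  simp [ZFAxiom.antiFoundation, Sentence.Realize, Formula.Realize, Fin.snoc] at this
  obtain ⟨f, hf, _⟩ := this X A e h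
  exact ⟨f, hf⟩

theorem exists_of_finite (hM : M ⊨ ZFA) {s : Set M} (hs : s.Finite) :
    ∃ c, ∀ z, MemRel z c ↔ z ∈ s := by
  induction s, hs using Set.Finite.induction_on with
  | empty => simpa using exists_empty hM
  | @insert a s _ _ ih =>
    obtain ⟨c, hc⟩ := ih
    obtain ⟨p, hp⟩ := exists_isPair hM a a
    obtain ⟨q, hq⟩ := exists_isPair hM p c
    obtain ⟨u, hu⟩ := exists_biUnion_set hM q
    refine ⟨u, fun z => ?_⟩
    simp [hu, hq _, or_and_right, exists_or, hp _, hc]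

theorem IsPair.eq_and_eq_or {p x y x' y' : M} (h : IsPair p x y) (h' : IsPair p x' y') :
    x = x' ∧ y = y' ∨ x = y' ∧ y = x' := by
  have h1 := (h' x).1 ((h x).2 (.inl rfl))
  have h2 := (h' y).1 ((h y).2 (.inr rfl))
  have h3 := (h x').1 ((h' x').2 (.inl rfl))
  have h4 := (h y').1 ((h' y').2 (.inr rfl))
  grind

theorem IsPair.unique (hM : M ⊨ ZFA) {p q x y : M} (hp : IsPair p x y) (hq : IsPair q x y) :
    p = q :=
  ext_of_model hM fun z => (hp z).trans (hq z).symm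

theorem exists_isOrdPair (hM : M ⊨ ZFA) (x y : M) : ∃ p, IsOrdPair p x y := by
  obtain ⟨q, hq⟩ := exists_isPair hM x x
  obtain ⟨r, hr⟩ := exists_isPair hM x y
  obtain ⟨p, hp⟩ := exists_isPair hM q r
  exact ⟨p, q, r, hq, hr, hp⟩

theorem IsOrdPair.unique (hM : M ⊨ ZFA) {p p' x y : M} (h : IsOrdPair p x y)
    (h' : IsOrdPair p' x y) : p = p' := by
  obtain ⟨q, r, hq, hr, hp⟩ := h
  obtain ⟨q', r', hq', hr', hp'⟩ := h'
  obtain rfl := hq.unique hM hq'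
  obtain rfl := hr.unique hM hr'
  exact hp.unique hM hp'

theorem IsOrdPair.injective {p x y x' y' : M} (h : IsOrdPair p x y) (h' : IsOrdPair p x' y') :
    x = x' ∧ y = y' := by
  obtain ⟨q, r, hq, hr, hp⟩ := h
  obtain ⟨q', r', hq', hr', hp'⟩ := h'
  rcases hp.eq_and_eq_or hp' with ⟨rfl, rfl⟩ | ⟨rfl, rfl⟩
  · have := hq.eq_and_eq_or hq'
    have := hr.eq_and_eq_or hr'
    grind
  · have := hq.eq_and_eq_or hr'
    have := hr.eq_and_eq_or hq'
    grind

/-- Every function on a finite set of elements of a model is represented by a set of the model. -/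
theorem exists_graph (hM : M ⊨ ZFA) {V : Type*} [Finite V] (x y : V → M) :
    ∃ f, ∀ p, MemRel p f ↔ ∃ v, IsOrdPair p (x v) (y v) := by
  choose p hp using fun v => exists_isOrdPair hM (x v) (y v)
  obtain ⟨f, hf⟩ := exists_of_finite hM (Set.finite_range p)
  refine ⟨f, fun q => (hf q).trans ⟨?_, ?_⟩⟩
  · rintro ⟨v, rfl⟩
    exact ⟨v, hp v⟩
  · rintro ⟨v, hv⟩
    exact ⟨v, (hp v).unique hM hv⟩

/-! ### Numerals -/

/-- Every model contains the standard von Neumann numerals. -/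
theorem exists_numerals (hM : M ⊨ ZFA) :
    ∃ num : ℕ → M, ∀ n z, MemRel z (num n) ↔ ∃ m < n, z = num m := by
  obtain ⟨o, ho⟩ := exists_empty hM
  have hsucc : ∀ a : M, ∃ b, ∀ z, MemRel z b ↔ MemRel z a ∨ z = a := fun a => by
    obtain ⟨p, hp⟩ := exists_isPair hM a a
    obtain ⟨q, hq⟩ := exists_isPair hM a p
    obtain ⟨u, hu⟩ := exists_biUnion_set hM q
    refine ⟨u, fun z => ?_⟩
    simp [hu, hq _, or_and_right, exists_or, hp _]
  choose succ hsucc using hsucc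
  refine ⟨fun n => Nat.rec o (fun _ a => succ a) n, fun n => ?_⟩
  induction n with
  | zero => simpa using ho
  | succ n ih =>
    intro z
    simp only [hsucc, ih, Nat.lt_succ_iff_lt_or_eq, or_and_right, exists_or, exists_eq_left]

section Numerals

variable {num : ℕ → M} (hnum : ∀ n z, MemRel z (num n) ↔ ∃ m < n, z = num m)
include hnum

/-- No numeral lies on a membership cycle of length two. -/
theorem not_memRel_and_memRel_numeral (n : ℕ) (z : M) :
    ¬ (MemRel z (num n) ∧ MemRel (num n) z) := by
  induction n using Nat.strong_induction_on generalizing z with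
  | _ n ih =>
    rintro ⟨h, h'⟩
    obtain ⟨m, hm, rfl⟩ := (hnum n z).1 h
    exact ih m hm _ ⟨h', h⟩

theorem numeral_injective : Function.Injective num := by
  intro m n h
  by_contra hne
  wlog hlt : m < n generalizing m n
  · exact this h.symm (Ne.symm hne) (by lia)
  have hmem : MemRel (num m) (num n) := (hnum n _).2 ⟨m, hlt, rfl⟩
  exact not_memRel_and_memRel_numeral hnum n (num m) ⟨hmem, h ▸ h ▸ hmem⟩

end Numerals

/-! ### Finite graphs as unions of connected components of the D-graph -/

/-- The relation `x ∈ y ∧ y ∈ x` of double membership. -/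
def DRel (x y : M) : Prop := MemRel x y ∧ MemRel y x

/-- A flat system of equations indexed by an external finite type, in which every equation has
exactly one parameter, has a solution. -/
theorem exists_solution_of_finite (hM : M ⊨ ZFA) {V : Type*} [Finite V] (r : V → V → Prop)
    {x a : V → M} (hx : x.Injective) (hxa : ∀ v w, x v ≠ a w) :
    ∃ F : V → M, ∀ v z, MemRel z (F v) ↔ (∃ w, r v w ∧ z = F w) ∨ z = a v := by
  obtain ⟨X, hX⟩ := exists_of_finite hM (Set.finite_range x)
  obtain ⟨A, hA⟩ := exists_of_finite hM (Set.finite_range a)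
  choose s hs using fun v =>
    exists_of_finite hM (((Set.toFinite {w | r v w}).image x).insert (a v))
  obtain ⟨e, he⟩ := exists_graph hM x s
  have hes : ∀ v t, PairMem e (x v) t ↔ t = s v := by
    refine fun v t => ⟨?_, ?_⟩
    · rintro ⟨p, hp, hpe⟩
      obtain ⟨w, hw⟩ := (he p).1 hpe
      obtain ⟨h1, rfl⟩ := hp.injective hw
      rw [hx h1]
    · rintro rfl
      obtain ⟨p, hp⟩ := exists_isOrdPair hM (x v) (s v)
      exact ⟨p, hp, (he p).2 ⟨v, hp⟩⟩
  have hflat : IsFlatSystem X A e := by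
    refine ⟨?_, ⟨fun p hp => ?_, fun y hy => ?_⟩, ?_⟩
    · rintro y ⟨h1, h2⟩
      obtain ⟨v, rfl⟩ := (hX y).1 h1
      obtain ⟨w, hw⟩ := (hA _).1 h2
      exact hxa v w hw.symm
    · obtain ⟨v, hv⟩ := (he p).1 hp
      exact ⟨_, _, (hX _).2 ⟨v, rfl⟩, hv⟩
    · obtain ⟨v, rfl⟩ := (hX y).1 hy
      exact ⟨s v, (hes v _).2 rfl, fun z => (hes v z).1⟩
    · rintro y t ⟨hy, hyt⟩ z hz
      obtain ⟨v, rfl⟩ := (hX y).1 hy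
      obtain rfl := (hes v t).1 hyt
      rcases (hs v z).1 hz with rfl | ⟨w, -, rfl⟩
      · exact .inr ((hA _).2 ⟨v, rfl⟩)
      · exact .inl ((hX _).2 ⟨w, rfl⟩)
  obtain ⟨f, ⟨-, hf⟩, hsol⟩ := exists_solution hM hflat
  choose F hF hFu using fun v => hf (x v) ((hX _).2 ⟨v, rfl⟩)
  refine ⟨F, fun v z => ?_⟩
  rw [hsol (x v) (s v) (F v) ⟨(hX _).2 ⟨v, rfl⟩, (hes v _).2 rfl, hF v⟩ z]
  refine or_congr ⟨?_, ?_⟩ ⟨?_, ?_⟩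
  · rintro ⟨y, hys, hyX, hyz⟩
    rcases (hs v y).1 hys with rfl | ⟨w, hw, rfl⟩
    · obtain ⟨w, hw⟩ := (hX _).1 hyX
      exact absurd hw (hxa w v)
    · exact ⟨w, hw, hFu w z hyz⟩
  · rintro ⟨w, hw, rfl⟩
    exact ⟨x w, (hs v _).2 (.inr ⟨w, hw, rfl⟩), (hX _).2 ⟨w, rfl⟩, hF w⟩
  · rintro ⟨h1, h2⟩
    rcases (hs v z).1 h1 with rfl | ⟨w, -, rfl⟩
    · rfl
    · obtain ⟨u, hu⟩ := (hA _).1 h2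
      exact absurd hu.symm (hxa w u)
  · rintro rfl
    exact ⟨(hs v _).2 (.inl rfl), (hA _).2 ⟨v, rfl⟩⟩

/-- A finite symmetric graph without isolated vertices is a union of connected components of the
D-graph: it is the D-graph of the solution of `x_v = {x_w | w adjacent to v} ∪ {a_v}`, where the
`a_v` are distinct numerals. The numerals keep the `x_v` apart, and add no edges since they do not
lie on membership cycles. -/
theorem exists_embedding_of_finite_graph (hM : M ⊨ ZFA) {V : Type*} [Finite V]
    {r : V → V → Prop} (hsymm : ∀ v w, r v w → r w v) (hr : ∀ v, ∃ w, r v w) :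
    ∃ F : V → M, F.Injective ∧ ∀ v z, DRel (F v) z ↔ ∃ w, r v w ∧ z = F w := by
  obtain ⟨num, hnum⟩ := exists_numerals hM
  have hinj := numeral_injective hnum
  obtain ⟨k, ⟨c⟩⟩ := Finite.exists_equiv_fin V
  obtain ⟨F, hF⟩ := exists_solution_of_finite hM r (x := fun v => num (2 * c v))
    (a := fun v => num (2 * c v + 1))
    (fun v w h => c.injective (Fin.ext (by have := hinj h; lia)))
    (fun v w h => by have := hinj h; lia)
  -- `F v` lies on a membership cycle of length two with `F w`, for any neighbour `w` of `v`.
  have hFnum : ∀ v n, F v ≠ num n := by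
    intro v n h
    obtain ⟨w, hw⟩ := hr v
    refine not_memRel_and_memRel_numeral hnum n (F w) (h ▸ ⟨?_, ?_⟩)
    · exact (hF v _).2 (.inl ⟨w, hw, rfl⟩)
    · exact (hF w _).2 (.inl ⟨v, hsymm _ _ hw, rfl⟩)
  refine ⟨F, fun v w h => ?_, fun v z => ⟨?_, ?_⟩⟩
  · have hv : MemRel (num (2 * c v + 1)) (F w) := h ▸ (hF v _).2 (.inr rfl)
    rcases (hF w _).1 hv with ⟨u, -, hu⟩ | hu
    · exact absurd hu.symm (hFnum u _)
    · exact c.injective (Fin.ext (by have := hinj hu; lia))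
  · rintro ⟨h1, h2⟩
    rcases (hF v z).1 h2 with h | rfl
    · exact h
    · obtain ⟨m, -, hm⟩ := (hnum _ _).1 h1
      exact absurd hm (hFnum v m)
  · rintro ⟨w, hw, rfl⟩
    exact ⟨(hF w _).2 (.inl ⟨v, hsymm _ _ hw, rfl⟩), (hF v _).2 (.inl ⟨w, hw, rfl⟩)⟩

end FiniteSets

/-! ### Coding finite sets of natural numbers by trees -/

section Coding

variable {M : Type*}

/-- `y` has at most `k` neighbours under `R`. -/
def NbrsAtMost (R : M → M → Prop) (k : ℕ) (y : M) : Prop :=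
  ∃ z : Fin k → M, ∀ w, R y w → ∃ i, w = z i

/-- `n` belongs to the set of natural numbers coded by `x` in the graph `R`: some neighbour of `x`
has exactly `n + 1` neighbours. -/
def Codes (R : M → M → Prop) (n : ℕ) (x : M) : Prop :=
  ∃ y, R x y ∧ NbrsAtMost R (n + 1) y ∧ ¬ NbrsAtMost R n y

/-- If the neighbours of `y` are enumerated without repetition by a type with `n + 1` elements,
then `y` has at most `k` neighbours exactly when `n + 1 ≤ k`. -/
theorem nbrsAtMost_iff {R : M → M → Prop} {y : M} {n : ℕ} {g : Option (Fin n) → M}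
    (hg : g.Injective) (hR : ∀ w, R y w ↔ ∃ i, w = g i) (k : ℕ) :
    NbrsAtMost R k y ↔ n + 1 ≤ k := by
  constructor
  · rintro ⟨z, hz⟩
    choose i hi using fun j => hz (g j) ((hR _).2 ⟨j, rfl⟩)
    have hinj : i.Injective := fun j j' h => hg (by rw [hi j, hi j', h])
    simpa using Fintype.card_le_of_injective i hinj
  · intro h
    obtain ⟨e⟩ : Nonempty (Option (Fin n) ↪ Fin k) :=
      Function.Embedding.nonempty_of_card_le (by simpa using h)
    refine ⟨fun i => g (Function.invFun e i), fun w hw => ?_⟩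
    obtain ⟨j, rfl⟩ := (hR w).1 hw
    exact ⟨e j, congrArg g (Function.leftInverse_invFun e.injective j).symm⟩

/-- Adjacency in the tree coding a set `b` of natural numbers. The vertices are a root `none`, for
each `n ∈ b` a child `some ⟨n, none⟩` of the root, and `n` leaves `some ⟨n, some j⟩` below it. -/
def treeAdj (b : Finset ℕ) : (v w : Option (Σ n : b, Option (Fin n))) → Prop
  | none, some ⟨_, none⟩ => True
  | some ⟨_, none⟩, none => True
  | some ⟨m, none⟩, some ⟨n, some _⟩ => m = n
  | some ⟨m, some _⟩, some ⟨n, none⟩ => m = n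
  | _, _ => False

theorem treeAdj_symm {b : Finset ℕ} : ∀ v w, treeAdj b v w → treeAdj b w v
  | none, some ⟨_, none⟩, h => h
  | some ⟨_, none⟩, none, h => h
  | some ⟨_, none⟩, some ⟨_, some _⟩, h => Eq.symm h
  | some ⟨_, some _⟩, some ⟨_, none⟩, h => Eq.symm h

theorem exists_treeAdj {b : Finset ℕ} (hb : b.Nonempty) : ∀ v, ∃ w, treeAdj b v w
  | none => ⟨some ⟨⟨hb.choose, hb.choose_spec⟩, none⟩, trivial⟩
  | some ⟨_, none⟩ => ⟨none, trivial⟩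
  | some ⟨n, some _⟩ => ⟨some ⟨n, none⟩, rfl⟩

theorem treeAdj_none_iff {b : Finset ℕ} :
    ∀ w, treeAdj b none w ↔ ∃ n, w = some ⟨n, none⟩
  | none => by simp [treeAdj]
  | some ⟨n, none⟩ => by simp [treeAdj]
  | some ⟨n, some _⟩ => by simp [treeAdj]

/-- The neighbours of a child `n` of the root: the root, indexed by `none`, and the `n` leaves. -/
def childNbr {b : Finset ℕ} (n : b) : Option (Fin n) → Option (Σ n : b, Option (Fin n)) :=
  Option.map fun j => ⟨n, some j⟩

theorem childNbr_injective {b : Finset ℕ} (n : b) : (childNbr n).Injective :=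
  Option.map_injective fun i j h => by simpa using h

theorem treeAdj_child_iff {b : Finset ℕ} (n : b) :
    ∀ w, treeAdj b (some ⟨n, none⟩) w ↔ ∃ i, w = childNbr n i
  | none => by simp [treeAdj, childNbr]
  | some ⟨m, none⟩ => by
    simp only [treeAdj, childNbr, Option.exists, Option.map_none, Option.map_some, reduceCtorEq,
      false_or, Option.some.injEq, false_iff]
    rintro ⟨i, hi⟩
    obtain rfl : m = n := congrArg Sigma.fst hi
    simp at hi
  | some ⟨m, some j⟩ => by
    simp only [treeAdj, childNbr, Option.exists, Option.map_none, Option.map_some, reduceCtorEq,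
      false_or, Option.some.injEq]
    constructor
    · rintro rfl
      exact ⟨j, rfl⟩
    · rintro ⟨i, hi⟩
      exact (congrArg Sigma.fst hi).symm

variable [langSet.Structure M]

/-- The root of the tree `treeAdj b`, realised in the D-graph, codes `b`. -/
theorem exists_codes_iff_mem (hM : M ⊨ ZFA) {b : Finset ℕ} (hb : b.Nonempty) :
    ∃ x : M, ∀ n, Codes DRel n x ↔ n ∈ b := by
  obtain ⟨F, hFinj, hF⟩ :=
    exists_embedding_of_finite_graph hM (treeAdj_symm (b := b)) (exists_treeAdj hb)
  have key : ∀ (m : b) k, NbrsAtMost DRel k (F (some ⟨m, none⟩)) ↔ m + 1 ≤ k := fun m =>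
    nbrsAtMost_iff (g := F ∘ childNbr m) (hFinj.comp (childNbr_injective m)) fun w => by
      simp [hF, treeAdj_child_iff]
  refine ⟨F none, fun n => ⟨?_, fun hn => ?_⟩⟩
  · rintro ⟨y, hy, h1, h2⟩
    obtain ⟨w, hw, rfl⟩ := (hF _ _).1 hy
    obtain ⟨m, rfl⟩ := (treeAdj_none_iff w).1 hw
    rw [key] at h1 h2
    obtain rfl : n = m := by lia
    exact m.2
  · refine ⟨F (some ⟨⟨n, hn⟩, none⟩), (hF _ _).2 ⟨_, (treeAdj_none_iff _).2 ⟨_, rfl⟩, rfl⟩, ?_, ?_⟩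
    · rw [key]
    · rw [key]
      simp

end Coding

/-! ### Translating formulas along definitions of relations -/

section Translation

variable {L L' : FirstOrder.Language.{0, 0}} [L.IsRelational]

/-- The variable that a term of a relational language consists of. -/
def relTermVar {α : Type} : L.Term α → α
  | .var a => a
  | .func f _ => isEmptyElim f

theorem realize_relTermVar {α : Type} {M : Type*} [L.Structure M] (v : α → M) :
    ∀ t : L.Term α, t.realize v = v (relTermVar t)
  | .var _ => rfl
  | .func f _ => isEmptyElim f

/-- Replace every relation symbol `R` of a relational language by its definition `θ R` in another
language. -/
def unfoldRelations (θ : ∀ {l}, L.Relations l → L'.Formula (Fin l)) {α : Type} :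
    ∀ {n}, L.BoundedFormula α n → L'.BoundedFormula α n
  | _, .falsum => .falsum
  | _, .equal t₁ t₂ => .equal (.var (relTermVar t₁)) (.var (relTermVar t₂))
  | _, .rel R ts => BoundedFormula.relabel (fun i => relTermVar (ts i)) (θ R)
  | _, .imp φ ψ => .imp (unfoldRelations θ φ) (unfoldRelations θ ψ)
  | _, .all φ => .all (unfoldRelations θ φ)

variable {θ : ∀ {l}, L.Relations l → L'.Formula (Fin l)} {M : Type*} [L.Structure M]
  [L'.Structure M]

theorem realize_unfoldRelations
    (hθ : ∀ {l} (R : L.Relations l) (v : Fin l → M), (θ R).Realize v ↔ Structure.RelMap R v)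
    {α : Type} {n : ℕ} (φ : L.BoundedFormula α n) (v : α → M) (xs : Fin n → M) :
    (unfoldRelations θ φ).Realize v xs ↔ φ.Realize v xs := by
  induction φ with
  | falsum => rfl
  | equal t₁ t₂ => simp [unfoldRelations, BoundedFormula.Realize, realize_relTermVar]
  | rel R ts =>
    simp only [unfoldRelations, BoundedFormula.Realize, realize_relTermVar]
    rw [← hθ R]
    refine BoundedFormula.realize_relabel.trans ?_
    rw [Formula.Realize]
    exact iff_of_eq (congrArg₂ _ rfl (Subsingleton.elim _ _))
  | imp φ ψ ihφ ihψ => simp [unfoldRelations, ihφ, ihψ]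
  | all φ ih => simp [unfoldRelations, ih]

/-- Structures definable in the same way in elementarily equivalent structures are elementarily
equivalent. -/
theorem elementarilyEquivalent_of_unfoldRelations {N : Type*} [L.Structure N] [L'.Structure N]
    (hθ : ∀ {l} (R : L.Relations l) (v : Fin l → M), (θ R).Realize v ↔ Structure.RelMap R v)
    (hθ' : ∀ {l} (R : L.Relations l) (v : Fin l → N), (θ R).Realize v ↔ Structure.RelMap R v)
    (h : M ≅[L'] N) : M ≅[L] N := by
  refine elementarilyEquivalent_iff.2 fun φ => ?_
  have := elementarilyEquivalent_iff.1 h (unfoldRelations θ φ)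
  simp only [Sentence.Realize, Formula.Realize] at this ⊢
  rwa [realize_unfoldRelations hθ, realize_unfoldRelations hθ'] at this

end Translation

/-! ### The graphs as definable reducts -/

instance : langSD.IsRelational := fun _ => inferInstanceAs (IsEmpty Empty)

instance : langD.IsRelational := fun _ => inferInstanceAs (IsEmpty Empty)

/-- The definitions of `S` and `D` in the language of set theory. -/
def sdDefinition : ∀ {l}, langSD.Relations l → langSet.Formula (Fin l)
  | _, SDSymb.S => Relations.formula₂ (L := langSet) MemSymb.mem (.var 0) (.var 1) ⊔
      Relations.formula₂ (L := langSet) MemSymb.mem (.var 1) (.var 0)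
  | _, SDSymb.D => Relations.formula₂ (L := langSet) MemSymb.mem (.var 0) (.var 1) ⊓
      Relations.formula₂ (L := langSet) MemSymb.mem (.var 1) (.var 0)

/-- The definition of `D` in the language of set theory. -/
def dDefinition : ∀ {l}, langD.Relations l → langSet.Formula (Fin l)
  | _, DSymb.D => Relations.formula₂ (L := langSet) MemSymb.mem (.var 0) (.var 1) ⊓
      Relations.formula₂ (L := langSet) MemSymb.mem (.var 1) (.var 0)

instance (M : Type*) [langSet.Structure M] : langSet.Structure (SDGraph M) :=
  inferInstanceAs (langSet.Structure M)

instance (M : Type*) [langSet.Structure M] : langSet.Structure (DGraph M) :=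
  inferInstanceAs (langSet.Structure M)

section Graphs

variable {M : Type*} [langSet.Structure M]

theorem realize_memFormula {α : Type} {v : α → M} {a b : α} :
    (Relations.formula₂ (L := langSet) MemSymb.mem (.var a) (.var b)).Realize v ↔
      MemRel (v a) (v b) :=
  Formula.realize_rel₂

theorem realize_sdDefinition {l : ℕ} (R : langSD.Relations l) (v : Fin l → SDGraph M) :
    (sdDefinition R).Realize v ↔ Structure.RelMap R v := by
  cases R
  · exact Formula.realize_sup.trans (or_congr realize_memFormula realize_memFormula)
  · exact Formula.realize_inf.trans (and_congr realize_memFormula realize_memFormula)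

theorem realize_dDefinition {l : ℕ} (R : langD.Relations l) (v : Fin l → DGraph M) :
    (dDefinition R).Realize v ↔ Structure.RelMap R v := by
  cases R
  exact Formula.realize_inf.trans (and_congr realize_memFormula realize_memFormula)

theorem sdGraph_elementarilyEquivalent {N : Type*} [langSet.Structure N] (h : M ≅[langSet] N) :
    SDGraph M ≅[langSD] SDGraph N :=
  elementarilyEquivalent_of_unfoldRelations realize_sdDefinition realize_sdDefinition h

theorem dGraph_elementarilyEquivalent {N : Type*} [langSet.Structure N] (h : M ≅[langSet] N) :
    DGraph M ≅[langD] DGraph N :=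
  elementarilyEquivalent_of_unfoldRelations realize_dDefinition realize_dDefinition h

theorem realize_dFormula {α : Type} {v : α → DGraph M} {a b : α} :
    (Relations.formula₂ (L := langD) DSymb.D (.var a) (.var b)).Realize v ↔
      DRel (M := M) (v a) (v b) :=
  Formula.realize_rel₂ (M := DGraph M)

theorem realize_dBoundedFormula {α : Type} {n : ℕ} {v : α → DGraph M} {xs : Fin n → DGraph M}
    {t t' : langD.Term (α ⊕ Fin n)} :
    (Relations.boundedFormula₂ (L := langD) DSymb.D t t').Realize v xs ↔
      DRel (M := M) (t.realize (M := DGraph M) (Sum.elim v xs))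
        (t'.realize (M := DGraph M) (Sum.elim v xs)) :=
  BoundedFormula.realize_rel₂ (M := DGraph M)

/-- The D-graph is a definable reduct of the SD-graph. -/
def dGraphEquivOfSDGraphEquiv {N : Type*} [langSet.Structure N]
    (e : SDGraph M ≃[langSD] SDGraph N) : DGraph M ≃[langD] DGraph N where
  toEquiv := e.toEquiv
  map_fun' f := isEmptyElim f
  map_rel'
    | DSymb.D, v => e.map_rel SDSymb.D v

end Graphs

/-! ### The coding formulas -/

section CodingFormulas

/-- The formula "`a` has at most `k` neighbours". -/
noncomputable def nbrsAtMostFormula {α : Type} (k : ℕ) (a : α) : langD.Formula α :=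
  BoundedFormula.exs (n := k) (∀' (
    Relations.boundedFormula₂ (L := langD) DSymb.D (.var (.inl a)) (.var (.inr (Fin.last k))) ⟹
    BoundedFormula.iSup fun i : Fin k =>
      Term.bdEqual (.var (.inr (Fin.last k))) (.var (.inr i.castSucc))))

/-- The formula "`n` belongs to the set coded by `x`". -/
noncomputable def codesFormula (n : ℕ) : langD.Formula Unit :=
  Formula.iExs Unit (α := Unit)
    (Relations.formula₂ (L := langD) DSymb.D (.var (.inl ())) (.var (.inr ())) ⊓
      (nbrsAtMostFormula (n + 1) (.inr ()) ⊓ ∼ (nbrsAtMostFormula n (.inr ()))))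

variable {M : Type*} [langSet.Structure M]

theorem realize_nbrsAtMostFormula {α : Type} (k : ℕ) (a : α) (v : α → DGraph M) :
    (nbrsAtMostFormula k a).Realize v ↔ NbrsAtMost (M := M) DRel k (v a) := by
  simp only [nbrsAtMostFormula, BoundedFormula.realize_exs, BoundedFormula.realize_all,
    BoundedFormula.realize_imp, realize_dBoundedFormula, BoundedFormula.realize_iSup,
    BoundedFormula.realize_bdEqual, Term.realize_var, Sum.elim_inl, Sum.elim_inr, Fin.snoc_last,
    Fin.snoc_castSucc]
  rfl

theorem realize_codesFormula (n : ℕ) (v : Unit → DGraph M) :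
    (codesFormula n).Realize v ↔ Codes (M := M) DRel n (v ()) := by
  simp only [codesFormula, Formula.realize_iExs, Formula.realize_inf, Formula.realize_not,
    realize_dFormula, realize_nbrsAtMostFormula, Sum.elim_inl, Sum.elim_inr]
  exact ⟨fun ⟨i, h⟩ => ⟨i (), h⟩, fun ⟨y, h⟩ => ⟨fun _ => y, h⟩⟩

theorem codes_map_iff {N : Type*} [langSet.Structure N] (e : DGraph M ≃[langD] DGraph N) (n : ℕ)
    (x : DGraph M) : Codes (M := N) DRel n (e x) ↔ Codes (M := M) DRel n x := by
  rw [← realize_codesFormula (M := M) n fun _ => x, ← StrongHomClass.realize_formula e,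
    realize_codesFormula]
  rfl

/-- The coding formula, stated in the language of set theory. -/
theorem realize_unfoldRelations_codesFormula (n : ℕ) (v : Unit → M) :
    Formula.Realize (M := M) (unfoldRelations dDefinition (codesFormula n) : langSet.Formula Unit) v ↔
      Codes DRel n (v ()) :=
  (realize_unfoldRelations (M := DGraph M) realize_dDefinition (codesFormula n) v default).trans
    (realize_codesFormula n v)

end CodingFormulas

/-! ### Models in which a given set is coded -/

section Compactness

theorem card_langSet : langSet.card ≤ Cardinal.aleph0 := by
  have h2 : Countable (Σ l, langSet.Relations l) := by
    refine Function.Injective.countable (β := Unit) (f := fun _ => ()) ?_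
    rintro ⟨_, ⟨⟩⟩ ⟨_, ⟨⟩⟩ _
    rfl
  have h1 : IsEmpty (Σ l, langSet.Functions l) := ⟨fun f => Empty.elim f.2⟩
  have : Countable langSet.Symbols := by
    unfold Language.Symbols
    infer_instance
  exact Cardinal.mk_le_aleph0

variable {M : Type u} [langSet.Structure M]

/-- The theory of `M` with a constant, which is said to code a set that agrees with `b` below
`k`. -/
def codingTheory (M : Type u) [langSet.Structure M] (b : Set ℕ) (k : ℕ) : langSet[[Unit]].Theory :=
  (langSet.lhomWithConstants Unit).onTheory (langSet.completeTheory M) ∪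
    {σ | ∃ n < k, ∃ φ : langSet.Formula Unit, φ = unfoldRelations dDefinition (codesFormula n) ∧
      (n ∈ b ∧ σ = Formula.equivSentence φ ∨ n ∉ b ∧ σ = Formula.equivSentence (∼ φ))}

theorem codingTheory_mono (b : Set ℕ) : Monotone (codingTheory M b) := by
  intro k l hkl
  unfold codingTheory
  refine Set.union_subset_union_right _ ?_
  rintro σ ⟨n, hn, h⟩
  exact ⟨n, hn.trans_le hkl, h⟩

theorem model_codingTheory_iff {N : Type*} [langSet.Structure N] [langSet[[Unit]].Structure N]
    [(langSet.lhomWithConstants Unit).IsExpansionOn N] {b : Set ℕ} {k : ℕ} :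
    N ⊨ codingTheory M b k ↔ N ⊨ langSet.completeTheory M ∧
      ∀ n < k, (Codes DRel n ((langSet.con () : langSet[[Unit]].Constants) : N) ↔ n ∈ b) := by
  rw [codingTheory, Theory.model_union_iff, LHom.onTheory_model]
  refine and_congr_right fun _ => ?_
  rw [Theory.model_iff]
  constructor
  · intro h n hn
    by_cases hb : n ∈ b
    · have := h _ ⟨n, hn, _, rfl, .inl ⟨hb, rfl⟩⟩
      rw [Formula.realize_equivSentence, realize_unfoldRelations_codesFormula] at this
      exact iff_of_true this hb
    · have := h _ ⟨n, hn, _, rfl, .inr ⟨hb, rfl⟩⟩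
      rw [Formula.realize_equivSentence, Formula.realize_not,
        realize_unfoldRelations_codesFormula] at this
      exact iff_of_false this hb
  · rintro h σ ⟨n, hn, φ, rfl, ⟨hb, rfl⟩ | ⟨hb, rfl⟩⟩
    · rw [Formula.realize_equivSentence, realize_unfoldRelations_codesFormula]
      exact (h n hn).2 hb
    · rw [Formula.realize_equivSentence, Formula.realize_not, realize_unfoldRelations_codesFormula]
      exact fun hc => hb ((h n hn).1 hc)

theorem isSatisfiable_codingTheory (hM : M ⊨ ZFA) (b : Set ℕ) (k : ℕ) :
    (codingTheory M b k).IsSatisfiable := by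
  classical
  -- The extra element `k` makes the coded set nonempty and is invisible below `k`.
  obtain ⟨x, hx⟩ := exists_codes_iff_mem hM
    (b := insert k ((Finset.range k).filter (· ∈ b))) (Finset.insert_nonempty _ _)
  let := constantsOn.structure fun _ : Unit => x
  have : Nonempty M := ⟨x⟩
  have : M ⊨ codingTheory M b k := by
    refine model_codingTheory_iff.2 ⟨inferInstance, fun n hn => ?_⟩
    refine (hx n).trans ?_
    simp [hn, hn.ne]
  exact Theory.Model.isSatisfiable M

/-- Every set of natural numbers is coded in a countable model elementarily equivalent to `M`. -/
theorem exists_countable_model_codes (hM : M ⊨ ZFA) (b : Set ℕ) :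
    ∃ N : Bundled.{0} langSet.Structure, Countable N ∧ N ⊨ ZFA ∧ (N ≅[langSet] M) ∧
      ∃ x : N, ∀ n, Codes DRel n x ↔ n ∈ b := by
  obtain ⟨K⟩ := (Theory.isSatisfiable_directed_union_iff (codingTheory_mono (M := M) b).directed_le).2
    (isSatisfiable_codingTheory hM b)
  let : langSet.Structure K := (langSet.lhomWithConstants Unit).reduct K
  have : (langSet.lhomWithConstants Unit).IsExpansionOn K :=
    (langSet.lhomWithConstants Unit).isExpansionOn_reduct K
  have hK : ∀ k, K ⊨ codingTheory M b k := fun k => K.is_model.mono (Set.subset_iUnion _ k)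
  have hKM : K ≅[langSet] M := by
    have := (model_codingTheory_iff.1 (hK 0)).1
    exact elementarilyEquivalent_iff.2 fun φ => realize_iff_of_model_completeTheory M K φ
  have hKZ : K ⊨ ZFA := hKM.theory_model_iff.2 hM
  obtain ⟨S, hxS, hS⟩ := exists_elementarySubstructure_card_eq langSet
    ({((langSet.con () : langSet[[Unit]].Constants) : K)} : Set K) Cardinal.aleph0.{0} le_rfl
    (by simp) (by simpa using card_langSet) (by
      obtain ⟨num, hnum⟩ := exists_numerals hKZ
      have := Infinite.of_injective num (numeral_injective hnum)
      simp)
  have hSM : S ≅[langSet] M := (S.elementarilyEquivalent.trans hKM)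
  refine ⟨⟨S, inferInstance⟩, Cardinal.mk_le_aleph0_iff.1 (by simpa using hS.le),
    hSM.theory_model_iff.2 hM, hSM, ⟨_, hxS rfl⟩, fun n => ?_⟩
  rw [← (model_codingTheory_iff.1 (hK (n + 1))).2 n n.lt_succ_self]
  have := S.subtype.map_formula (unfoldRelations dDefinition (codesFormula n)) fun _ => ⟨_, hxS rfl⟩
  rw [realize_unfoldRelations_codesFormula, realize_unfoldRelations_codesFormula] at this
  exact this.symm

end Compactness

/-! ### Counting isomorphism classes -/

section Counting

open Cardinal

theorem quotient_mk_eq_iff {L : FirstOrder.Language.{0, 0}} {N N' : Bundled.{0} L.Structure} :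
    (Quotient.mk _ N : Quotient (FirstOrder.Language.equivSetoid (L := L))) = Quotient.mk _ N' ↔
      Nonempty (N ≃[L] N') :=
  Quotient.eq

/-- There are continuum many countable models of the theory of `M` whose D-graphs are pairwise
non-isomorphic: every set of natural numbers is coded in some countable model, and the D-graph of a
countable model only codes countably many sets. -/
theorem exists_continuum_pairwise_not_iso {M : Type u} [langSet.Structure M] (hM : M ⊨ ZFA) :
    ∃ 𝒩 : Set (Bundled.{0} langSet.Structure), #𝒩 = continuum ∧
      (∀ N ∈ 𝒩, Countable N ∧ N ⊨ ZFA ∧ (N ≅[langSet] M)) ∧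
      𝒩.Pairwise fun N N' => IsEmpty (DGraph N ≃[langD] DGraph N') := by
  choose N hN hNZ hNM x hx using exists_countable_model_codes hM
  let G : Set ℕ → Bundled.{0} langD.Structure := fun b => ⟨DGraph (N b), inferInstance⟩
  let q : Set ℕ → Quotient (FirstOrder.Language.equivSetoid (L := langD)) := fun b =>
    Quotient.mk _ (G b)
  have hfib : ∀ b, #(q ⁻¹' {q b}) ≤ ℵ₀ := by
    intro b
    have he : ∀ c : q ⁻¹' {q b}, Nonempty (DGraph (N c) ≃[langD] DGraph (N b)) := fun c =>
      quotient_mk_eq_iff (N := G c) (N' := G b) |>.1 c.2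
    let e := fun c => (he c).some
    have hinj : Function.Injective (β := N b) fun c : q ⁻¹' {q b} => e c (x c) := by
      intro c c' h
      refine Subtype.ext (Set.ext fun n => ?_)
      have h1 := codes_map_iff (e c) n (x c)
      have h2 := codes_map_iff (e c') n (x c')
      rw [show e c (x c) = e c' (x c') from h] at h1
      exact (hx c n).symm.trans (h1.symm.trans (h2.trans (hx c' n)))
    -- `N b` is countable, and each `c` in the fibre is coded by an element of it.
    have : Countable (N b) := hN b
    exact Cardinal.mk_le_aleph0_iff.2 hinj.countable
  -- One model is chosen from each isomorphism class of D-graphs.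
  obtain ⟨s, hs⟩ : ∃ s : Set.range q → Set ℕ, ∀ c, q (s c) = c := ⟨_, fun c => c.2.choose_spec⟩
  have hinj : Function.Injective fun c => N (s c) := by
    intro c c' h
    refine Subtype.ext ?_
    rw [← hs c, ← hs c']
    exact congrArg (fun K : Bundled.{0} langSet.Structure =>
      (Quotient.mk _ (⟨DGraph K, inferInstance⟩ : Bundled.{0} langD.Structure) :
        Quotient (FirstOrder.Language.equivSetoid (L := langD)))) h
  have hcard : #(Set.range q) = continuum := by
    refine le_antisymm ?_ ?_
    · simpa using Cardinal.mk_range_le_lift (f := q)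
    · by_contra! hlt
      have hle := Cardinal.lift_mk_le_lift_mk_mul_of_lift_mk_preimage_le (c := ℵ₀)
        (Set.rangeFactorization q) (by
          rintro ⟨_, b, rfl⟩
          have : Set.rangeFactorization q ⁻¹' {⟨q b, b, rfl⟩} = q ⁻¹' {q b} :=
            Set.ext fun c => Subtype.ext_iff
          rw [this]
          simpa using hfib b)
      simp only [Cardinal.mk_set, Cardinal.mk_nat, Cardinal.two_power_aleph0,
        Cardinal.lift_continuum, Cardinal.lift_uzero] at hle
      exact (Cardinal.mul_lt_of_lt Cardinal.aleph0_le_continuum hlt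
        Cardinal.aleph0_lt_continuum).not_ge hle
  refine ⟨Set.range fun c => N (s c), ?_, ?_, ?_⟩
  · rw [Cardinal.mk_range_eq _ hinj, hcard]
  · rintro _ ⟨c, rfl⟩
    exact ⟨hN _, hNZ _, hNM _⟩
  · rintro _ ⟨c, rfl⟩ _ ⟨c', rfl⟩ hne
    refine ⟨fun e => hne ?_⟩
    have : q (s c) = q (s c') := quotient_mk_eq_iff (N := G (s c)) (N' := G (s c')) |>.2 ⟨e⟩
    rw [hs, hs] at this
    rw [Subtype.ext this]

/-- A countable relational language has at most continuum many countable structures up to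
isomorphism: transported to a subset of `ℕ`, such a structure is given by its domain and by the set
of tuples at which each relation holds. -/
theorem mk_countableIsoClasses_le (L : FirstOrder.Language.{0, 0}) [L.IsRelational]
    [Countable (Σ l, L.Relations l)] (P : Bundled.{0} L.Structure → Prop) :
    #(countableIsoClasses L P) ≤ continuum := by
  choose N hN hP hc using fun c : countableIsoClasses L P => c.2
  choose f hf using fun c => (hN c).exists_injective_nat
  let code : countableIsoClasses L P → Set ℕ × Set (Σ R : Σ l, L.Relations l, Fin R.1 → ℕ) :=
    fun c => (Set.range (f c), {p | ∃ v, Structure.RelMap p.1.2 v ∧ p.2 = f c ∘ v})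
  have hcode : code.Injective := by
    intro c c' h
    obtain ⟨h1, h2⟩ := Prod.ext_iff.1 h
    refine Subtype.ext ?_
    rw [hc c, hc c', quotient_mk_eq_iff]
    let e : N c ≃ N c' := (_root_.Equiv.ofInjective _ (hf c)).trans
      ((_root_.Equiv.setCongr h1).trans (_root_.Equiv.ofInjective _ (hf c')).symm)
    have he : ∀ x, f c' (e x) = f c x := fun x =>
      congrArg Subtype.val ((_root_.Equiv.ofInjective _ (hf c')).apply_symm_apply _)
    refine ⟨⟨e, fun g => isEmptyElim g, fun {l} R v => ?_⟩⟩
    have hmem : ∀ d (w : Fin l → N d), (⟨⟨l, R⟩, f d ∘ w⟩ : Σ R : Σ l, L.Relations l, Fin R.1 → ℕ) ∈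
        (code d).2 ↔ Structure.RelMap R w := by
      refine fun d w => ⟨?_, fun hw => ⟨w, hw, rfl⟩⟩
      rintro ⟨w', hw', heq⟩
      rwa [(hf d).comp_left heq]
    have hev : f c' ∘ e ∘ v = f c ∘ v := funext fun i => he (v i)
    change Structure.RelMap R (e ∘ v) ↔ _
    rw [← hmem c' (e ∘ v), ← hmem c v, hev]
    exact iff_of_eq (congrArg (_ ∈ ·) h2.symm)
  have hset : ∀ Y : Type, Countable Y → #(Set Y) ≤ continuum := fun Y _ => by
    rw [Cardinal.mk_set, ← Cardinal.two_power_aleph0]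
    exact Cardinal.power_le_power_left two_ne_zero Cardinal.mk_le_aleph0
  have hle := Cardinal.lift_mk_le_lift_mk_of_injective hcode
  rw [Cardinal.lift_uzero] at hle
  refine hle.trans (Cardinal.lift_le_continuum.2 ?_)
  rw [Cardinal.mk_prod, Cardinal.lift_uzero, Cardinal.lift_uzero,
    ← Cardinal.continuum_mul_self]
  exact mul_le_mul' (hset _ inferInstance) (hset _ inferInstance)

instance : Countable (Σ l, langSD.Relations l) := by
  refine Function.Injective.countable (β := Bool)
    (f := fun R => match R with | ⟨_, SDSymb.S⟩ => true | ⟨_, SDSymb.D⟩ => false) ?_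
  rintro ⟨_, _ | _⟩ ⟨_, _ | _⟩ h <;> first | rfl | cases h

instance : Countable (Σ l, langD.Relations l) := by
  refine Function.Injective.countable (β := Unit) (f := fun _ => ()) ?_
  rintro ⟨_, ⟨⟩⟩ ⟨_, ⟨⟩⟩ _
  rfl

/-- A continuum of countable structures with the property `P`, pairwise non-isomorphic, forces the
number of isomorphism classes to be the continuum. The structures arise as `G N`, `N ∈ 𝒩`. -/
theorem mk_countableIsoClasses_eq {L L' : FirstOrder.Language.{0, 0}} [L.IsRelational]
    [Countable (Σ l, L.Relations l)] {P : Bundled.{0} L.Structure → Prop}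
    {𝒩 : Set (Bundled.{0} L'.Structure)} (h𝒩 : #𝒩 = continuum)
    (G : Bundled.{0} L'.Structure → Bundled.{0} L.Structure)
    (hG : ∀ N ∈ 𝒩, Countable (G N) ∧ P (G N))
    (hne : 𝒩.Pairwise fun N N' => IsEmpty (G N ≃[L] G N')) :
    #(countableIsoClasses L P) = continuum := by
  refine le_antisymm (mk_countableIsoClasses_le L P) ?_
  rw [← h𝒩]
  refine Cardinal.mk_le_of_injective (f := fun N : 𝒩 =>
    (⟨Quotient.mk _ (G N), G N, (hG N N.2).1, (hG N N.2).2, rfl⟩ : countableIsoClasses L P)) ?_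
  intro N N' h
  obtain ⟨e⟩ := quotient_mk_eq_iff.1 (congrArg Subtype.val h)
  by_contra hN
  exact (hne N.2 N'.2 fun h' => hN (Subtype.ext h')).false e

end Counting

theorem mainTheorem1 {M : Type*} [langSet.Structure M] (hM : M ⊨ ZFA) :
    -- continuum-many countable models of `ZFA` with non-isomorphic D-graphs equivalent to `M₁`
    (∃ 𝒩 : Set (Bundled.{0} langSet.Structure),
      Cardinal.mk 𝒩 = Cardinal.continuum ∧
      (∀ N ∈ 𝒩, Countable N ∧ N ⊨ ZFA ∧ (DGraph N ≅[langD] DGraph M)) ∧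
      𝒩.Pairwise fun N N' => IsEmpty (DGraph N ≃[langD] DGraph N')) ∧
    -- continuum-many countable models of `ZFA` with non-isomorphic SD-graphs equivalent to `M₀`
    (∃ 𝒩 : Set (Bundled.{0} langSet.Structure),
      Cardinal.mk 𝒩 = Cardinal.continuum ∧
      (∀ N ∈ 𝒩, Countable N ∧ N ⊨ ZFA ∧ (SDGraph N ≅[langSD] SDGraph M)) ∧
      𝒩.Pairwise fun N N' => IsEmpty (SDGraph N ≃[langSD] SDGraph N')) ∧
    -- up to isomorphism, there are continuum-many countable D-graphs of models of `ZFA`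
    Cardinal.mk (countableIsoClasses langD fun G =>
      ∃ N : Bundled.{0} langSet.Structure, N ⊨ ZFA ∧ Nonempty (G ≃[langD] DGraph N)) =
        Cardinal.continuum ∧
    -- up to isomorphism, there are continuum-many countable SD-graphs of models of `ZFA`
    Cardinal.mk (countableIsoClasses langSD fun G =>
      ∃ N : Bundled.{0} langSet.Structure, N ⊨ ZFA ∧ Nonempty (G ≃[langSD] SDGraph N)) =
        Cardinal.continuum ∧
    -- up to isomorphism, the theory of `M₁` has continuum-many countable models
    Cardinal.mk (countableIsoClasses langD fun G =>
      G ⊨ langD.completeTheory (DGraph M)) = Cardinal.continuum ∧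
    -- up to isomorphism, the theory of `M₀` has continuum-many countable models
    Cardinal.mk (countableIsoClasses langSD fun G =>
      G ⊨ langSD.completeTheory (SDGraph M)) = Cardinal.continuum := by
  obtain ⟨𝒩, hcard, h𝒩, hD⟩ := exists_continuum_pairwise_not_iso hM
  have hSD : 𝒩.Pairwise fun N N' => IsEmpty (SDGraph N ≃[langSD] SDGraph N') :=
    hD.imp fun _ _ h => ⟨fun e => h.false (dGraphEquivOfSDGraphEquiv e)⟩
  have hDM : ∀ N ∈ 𝒩, DGraph N ≅[langD] DGraph M := fun N hN =>
    dGraph_elementarilyEquivalent (h𝒩 N hN).2.2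
  have hSDM : ∀ N ∈ 𝒩, SDGraph N ≅[langSD] SDGraph M := fun N hN =>
    sdGraph_elementarilyEquivalent (h𝒩 N hN).2.2
  refine ⟨⟨𝒩, hcard, fun N hN => ⟨(h𝒩 N hN).1, (h𝒩 N hN).2.1, hDM N hN⟩, hD⟩,
    ⟨𝒩, hcard, fun N hN => ⟨(h𝒩 N hN).1, (h𝒩 N hN).2.1, hSDM N hN⟩, hSD⟩, ?_, ?_, ?_, ?_⟩
  · exact mk_countableIsoClasses_eq hcard (fun N => ⟨DGraph N, inferInstance⟩)
      (fun N hN => ⟨(h𝒩 N hN).1, N, (h𝒩 N hN).2.1, ⟨.refl _ _⟩⟩) hD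
  · exact mk_countableIsoClasses_eq hcard (fun N => ⟨SDGraph N, inferInstance⟩)
      (fun N hN => ⟨(h𝒩 N hN).1, N, (h𝒩 N hN).2.1, ⟨.refl _ _⟩⟩) hSD
  · exact mk_countableIsoClasses_eq hcard (fun N => ⟨DGraph N, inferInstance⟩)
      (fun N hN => ⟨(h𝒩 N hN).1, (hDM N hN).theory_model_iff.2 inferInstance⟩) hD
  · exact mk_countableIsoClasses_eq hcard (fun N => ⟨SDGraph N, inferInstance⟩)
      (fun N hN => ⟨(h𝒩 N hN).1, (hSDM N hN).theory_model_iff.2 inferInstance⟩) hSD
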